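/- All graphs are finite, simple and connected. The (vertex) metric dimension $\dim(G)$ is the smallest cardinality of a set $S\subseteq V(G)$ such that for every two distinct vertices $x,y$ of $G$ there is $s\in S$ with $d(s,x)\neq d(s,y)$, where $d$ is the graph distance. A cactus graph is a connected graph in which distinct cycles are edge disjoint. A leaf is a vertex of degree $1$. A daisy graph is a graph comprised of cycles which all share one vertex, that is, $G$ is a union of cycles, there is a vertex $v$ (the center) lying on every cycle of $G$, and any two distinct cycles of $G$ have only $v$ in common; the cycles of a daisy graph are called petals, and a petal is odd if its length is odd. Let $G$ be a cactus graph with exactly $c\geq 2$ cycles and without leaves. Then $\dim(G)\leq 2c-1$, and equality holds if and only if $G$ is a daisy graph without odd petals. -/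

import Mathlib

namespace LeaflessCactus

/-- `S` is a (vertex) metric generator of `G`: every pair of distinct vertices is
distinguished by some vertex of `S`. -/
def IsMetricGenerator {V : Type*} (G : SimpleGraph V) (S : Finset V) : Prop :=
  ∀ x y : V, x ≠ y → ∃ s ∈ S, G.dist s x ≠ G.dist s y

/-- The (vertex) metric dimension: the cardinality of a smallest metric generator. -/
noncomputable def metricDim {V : Type*} (G : SimpleGraph V) : ℕ :=
  sInf {n : ℕ | ∃ S : Finset V, IsMetricGenerator G S ∧ S.card = n}

/-- A subgraph of `G` is a cycle of `G` if it is traced out by a cyclic walk. Cycles are taken as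
subgraphs, so that the starting point and the direction of the walk do not matter. -/
def IsCycleOf {V : Type*} {G : SimpleGraph V} (C : G.Subgraph) : Prop :=
  ∃ (u : V) (p : G.Walk u u), p.IsCycle ∧ p.toSubgraph = C

/-- The number of cycles of `G`. -/
noncomputable def numCycles {V : Type*} (G : SimpleGraph V) : ℕ :=
  {C : G.Subgraph | IsCycleOf C}.ncard

/-- A cactus graph: a connected graph whose cycles are pairwise edge disjoint. -/
def IsCactus {V : Type*} (G : SimpleGraph V) : Prop :=
  G.Connected ∧
    ∀ C D : G.Subgraph, IsCycleOf C → IsCycleOf D → C ≠ D → Disjoint C.edgeSet D.edgeSet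

/-- A leaf is a vertex of degree one. -/
def IsLeaf {V : Type*} (G : SimpleGraph V) (v : V) : Prop :=
  (G.neighborSet v).ncard = 1

/-- A daisy graph: every vertex and every edge lies on a cycle, and there is a vertex (the center)
that belongs to all the cycles and is the only common vertex of any two of them. -/
def IsDaisy {V : Type*} (G : SimpleGraph V) : Prop :=
  (∀ w : V, ∃ C : G.Subgraph, IsCycleOf C ∧ w ∈ C.verts) ∧
  (∀ e ∈ G.edgeSet, ∃ C : G.Subgraph, IsCycleOf C ∧ e ∈ C.edgeSet) ∧
  ∃ v : V, (∀ C : G.Subgraph, IsCycleOf C → v ∈ C.verts) ∧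
    ∀ C D : G.Subgraph, IsCycleOf C → IsCycleOf D → C ≠ D → C.verts ∩ D.verts = {v}

end LeaflessCactus

namespace LeaflessCactus

open SimpleGraph

/-! ### Cycles as sequences of vertices -/

section Cycle

variable {V : Type*} {G : SimpleGraph V} {v : V} {p : G.Walk v v}

/-! In a cactus every vertex `x` is tied to a cycle `C` through a single vertex, its gate. Distances
from `x` to `C` split at the gate, so as far as `C` is concerned a landmark may be replaced by its
gate; moreover all vertices of another cycle have the same gate on `C`.

Since there are no leaves, `S` is a metric generator once it resolves each cycle separately and,
whenever two cycles share a vertex `v`, surrounds `v` on at least one of them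
(`isMetricGenerator_of_resolvesCycle`). When `S` meets every cycle, each cycle has for free a
landmark at the gate of another cycle. Two further vertices then make it resolved and surrounded
everywhere, and one suffices for resolving alone. Hence any one cycle can be given a single vertex,
and the bound `2c - 1` follows.

A second vertex is saved if two cycles are disjoint, if some cycle is odd, or if some cycle meets
others in two different vertices. When none of this happens the graph is a daisy with even petals
(`isDaisy_of_meet`). There a petal containing only one landmark besides the center has a neighbour
of the center that is one step farther than the center from all landmarks. Two such petals would
give an unresolved pair, so all petals but one need two landmarks
(`two_mul_numCycles_le_of_isDaisy`). -/

theorem getVert_eq_getVert_iff (hp : p.IsCycle) {i j : ℕ} (hi : i ≤ p.length)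
    (hj : j ≤ p.length) : p.getVert i = p.getVert j ↔
      i = j ∨ (i = 0 ∧ j = p.length) ∨ (i = p.length ∧ j = 0) := by
  have hL := hp.three_le_length
  have h0 : p.getVert p.length = p.getVert 0 := by simp
  constructor
  · intro h
    rcases Nat.eq_zero_or_pos i with rfl | hi0
    · rcases Nat.eq_zero_or_pos j with rfl | hj0
      · exact Or.inl rfl
      · have := hp.getVert_injOn (x₁ := p.length) (x₂ := j) ⟨by omega, le_rfl⟩ ⟨hj0, hj⟩
          (h0.trans h)
        omega
    · rcases Nat.eq_zero_or_pos j with rfl | hj0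
      · have := hp.getVert_injOn (x₁ := i) (x₂ := p.length) ⟨hi0, hi⟩ ⟨by omega, le_rfl⟩
          (h.trans h0.symm)
        omega
      · exact Or.inl (hp.getVert_injOn ⟨hi0, hi⟩ ⟨hj0, hj⟩ h)
  · rintro (rfl | ⟨rfl, rfl⟩ | ⟨rfl, rfl⟩)
    · rfl
    · exact h0.symm
    · exact h0

theorem getVert_injective_of_lt (hp : p.IsCycle) {i j : ℕ} (hi : i < p.length)
    (hj : j < p.length) (h : p.getVert i = p.getVert j) : i = j := by
  have := (getVert_eq_getVert_iff hp hi.le hj.le).1 h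
  omega

theorem edge_getVert_injective (hp : p.IsCycle) {i j : ℕ} (hi : i < p.length)
    (hj : j < p.length)
    (h : s(p.getVert i, p.getVert (i + 1)) = s(p.getVert j, p.getVert (j + 1))) : i = j := by
  have hL := hp.three_le_length
  rw [Sym2.eq_iff, getVert_eq_getVert_iff hp (by omega) (by omega),
    getVert_eq_getVert_iff hp (by omega) (by omega),
    getVert_eq_getVert_iff hp (by omega) (by omega),
    getVert_eq_getVert_iff hp (by omega) (by omega)] at h
  omega

theorem exists_getVert_of_mem (hp : p.IsCycle) {x : V} (hx : x ∈ p.toSubgraph.verts) :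
    ∃ i < p.length, p.getVert i = x := by
  have hL := hp.three_le_length
  rw [Walk.mem_verts_toSubgraph, Walk.mem_support_iff_exists_getVert] at hx
  obtain ⟨n, hn, hle⟩ := hx
  rcases hle.lt_or_eq with h | h
  · exact ⟨n, h, hn⟩
  · subst h
    exact ⟨0, by omega, by simpa using hn⟩

theorem getVert_mem_verts (p : G.Walk v v) (i : ℕ) : p.getVert i ∈ p.toSubgraph.verts := by
  rw [Walk.mem_verts_toSubgraph]
  exact p.getVert_mem_support i

theorem IsCycleOf.exists_walk {C : G.Subgraph} (hC : IsCycleOf C) (hv : v ∈ C.verts) :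
    ∃ p : G.Walk v v, p.IsCycle ∧ p.toSubgraph = C := by
  classical
  obtain ⟨u, p, hp, rfl⟩ := hC
  rw [Walk.mem_verts_toSubgraph] at hv
  exact ⟨p.rotate v hv, hp.rotate hv, Walk.toSubgraph_rotate p hv⟩

theorem IsCycleOf.nonempty {C : G.Subgraph} (hC : IsCycleOf C) : ∃ v, v ∈ C.verts := by
  obtain ⟨u, p, hp, rfl⟩ := hC
  exact ⟨u, by simp⟩

theorem ncard_edgeSet_toSubgraph (hp : p.IsCycle) : p.toSubgraph.edgeSet.ncard = p.length := by
  classical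
  have h : p.toSubgraph.edgeSet = (p.edges.toFinset : Set (Sym2 V)) := by
    ext e
    simp
  rw [h, Set.ncard_coe_finset, List.toFinset_card_of_nodup hp.edges_nodup, Walk.length_edges]

end Cycle

/-! ### Gates -/

section Gate

variable {V : Type*} {G : SimpleGraph V} {C : G.Subgraph}

/-- A retraction onto the vertices of `C` that identifies the ends of every edge outside `C`. -/
structure IsGate (C : G.Subgraph) (r : V → V) : Prop where
  mem : ∀ x, r x ∈ C.verts
  self : ∀ x ∈ C.verts, r x = x
  eq_of_adj : ∀ x y, G.Adj x y → ¬ C.Adj x y → r x = r y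

/-- Once one edge of the cycle is deleted, the other is a bridge: a cycle through it would share an
edge with `p`, hence equal `p`, which uses the deleted edge. -/
theorem not_reachable_of_two_edges (hG : IsCactus G) {v : V} {p : G.Walk v v} (hp : p.IsCycle)
    {i j : ℕ} (hi : i < p.length) (hj : j < p.length) (hij : i ≠ j) :
    ¬ (G.deleteEdges {s(p.getVert i, p.getVert (i + 1)),
      s(p.getVert j, p.getVert (j + 1))}).Reachable (p.getVert i) (p.getVert (i + 1)) := by
  set e := s(p.getVert i, p.getVert (i + 1)) with he
  set f := s(p.getVert j, p.getVert (j + 1)) with hf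
  have hef : e ≠ f := fun h => hij (edge_getVert_injective hp hi hj h)
  have hep : e ∈ p.toSubgraph.edgeSet := by
    rw [he, Subgraph.mem_edgeSet, Walk.toSubgraph_adj_iff]
    exact ⟨i, rfl, hi⟩
  have hfp : f ∈ p.toSubgraph.edgeSet := by
    rw [hf, Subgraph.mem_edgeSet, Walk.toSubgraph_adj_iff]
    exact ⟨j, rfl, hj⟩
  have hbr : (G.deleteEdges {f}).IsBridge e := by
    rw [isBridge_iff_forall_cycle_notMem]
    · intro u q hq heq
      have hle : G.deleteEdges {f} ≤ G := deleteEdges_le _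
      have hq' : (q.mapLe hle).IsCycle := hq.mapLe hle
      have hD : p.toSubgraph = (q.mapLe hle).toSubgraph := by
        by_contra hne
        have := hG.2 _ _ ⟨v, p, hp, rfl⟩ ⟨u, q.mapLe hle, hq', rfl⟩ hne
        refine Set.disjoint_left.1 this hep ?_
        rw [Walk.mem_edges_toSubgraph, Walk.edges_mapLe_eq_edges]
        exact heq
      rw [hD, Walk.mem_edges_toSubgraph, Walk.edges_mapLe_eq_edges] at hfp
      have := q.edges_subset_edgeSet hfp
      rw [edgeSet_deleteEdges] at this
      exact this.2 rfl
    · rw [edgeSet_deleteEdges]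
      exact ⟨p.toSubgraph.edgeSet_subset hep, hef⟩
  rw [he, isBridge_iff, deleteEdges_deleteEdges, ← he] at hbr
  rwa [Set.pair_comm, Set.insert_eq]

theorem reachable_getVert {H : SimpleGraph V} {v : V} (p : G.Walk v v) {i j : ℕ} (hij : i ≤ j)
    (h : ∀ k, i ≤ k → k < j → H.Adj (p.getVert k) (p.getVert (k + 1))) :
    H.Reachable (p.getVert i) (p.getVert j) := by
  induction j, hij using Nat.le_induction with
  | base => exact Reachable.refl _
  | succ n hn ih =>
    exact (ih fun k h1 h2 => h k h1 (by omega)).trans (h n hn (by omega)).reachable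

/-- A connection outside `C` between positions `i < j`, closed up by the arc from `i + 1` to `j`,
would join the ends of edge `i` while avoiding edges `i` and `j`. This makes gates unique. -/
theorem eq_of_reachable_deleteEdges (hG : IsCactus G) (hC : IsCycleOf C) {a b : V}
    (ha : a ∈ C.verts) (hb : b ∈ C.verts) (h : (G.deleteEdges C.edgeSet).Reachable a b) :
    a = b := by
  obtain ⟨v, p, hp, rfl⟩ := hC
  obtain ⟨i, hi, rfl⟩ := exists_getVert_of_mem hp ha
  obtain ⟨j, hj, rfl⟩ := exists_getVert_of_mem hp hb
  clear ha hb
  wlog hij : i ≤ j generalizing i j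
  · exact (this j hj i hi h.symm (by omega)).symm
  rcases hij.eq_or_lt with rfl | hlt
  · rfl
  exfalso
  refine not_reachable_of_two_edges hG hp hi hj hlt.ne ?_
  refine Reachable.trans (h.mono ?_) (Reachable.symm ?_)
  · refine deleteEdges_anti ?_
    rintro e (rfl | rfl)
    · rw [Subgraph.mem_edgeSet, Walk.toSubgraph_adj_iff]
      exact ⟨i, rfl, hi⟩
    · rw [Subgraph.mem_edgeSet, Walk.toSubgraph_adj_iff]
      exact ⟨j, rfl, hj⟩
  · refine reachable_getVert p hlt fun k hk1 hk2 => ?_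
    rw [deleteEdges_adj]
    refine ⟨p.adj_getVert_succ (by omega), ?_⟩
    rintro (h' | h')
    · have := edge_getVert_injective hp (by omega) (by omega) h'
      omega
    · have := edge_getVert_injective hp (by omega) (by omega) h'
      omega

theorem exists_isGate (hG : IsCactus G) (hC : IsCycleOf C) : ∃ r, IsGate C r := by
  have hex : ∀ x, ∃ c ∈ C.verts, (G.deleteEdges C.edgeSet).Reachable x c := by
    obtain ⟨c, hc⟩ := hC.nonempty
    intro x
    obtain ⟨q⟩ := hG.1.preconnected x c
    induction q with
    | nil => exact ⟨_, hc, Reachable.refl _⟩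
    | @cons a b d hab q ih =>
      by_cases ha : a ∈ C.verts
      · exact ⟨a, ha, Reachable.refl _⟩
      · obtain ⟨c', hc', hr⟩ := ih hc
        refine ⟨c', hc', Reachable.trans (Adj.reachable ?_) hr⟩
        rw [deleteEdges_adj]
        exact ⟨hab, fun h => ha (C.edge_vert h)⟩
  choose r hr1 hr2 using hex
  refine ⟨r, hr1, fun x hx => (eq_of_reachable_deleteEdges hG hC hx (hr1 x) (hr2 x)).symm,
    fun x y hxy hn => eq_of_reachable_deleteEdges hG hC (hr1 x) (hr1 y) ?_⟩
  refine ((hr2 x).symm.trans (Adj.reachable ?_)).trans (hr2 y)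
  rw [deleteEdges_adj]
  exact ⟨hxy, hn⟩

open Classical in
/-- The vertex of the cycle `C` through which every path from `x` to `C` passes. -/
noncomputable def gate (C : G.Subgraph) : V → V :=
  if h : ∃ r, IsGate C r then h.choose else id

theorem isGate_gate (hG : IsCactus G) (hC : IsCycleOf C) : IsGate C (gate C) := by
  have h := exists_isGate hG hC
  rw [gate, dif_pos h]
  exact h.choose_spec

variable {r : V → V}

/-- Along a walk `r` can change only on an edge of `C`, and the start of the first such edge is its
own gate, equal to `r x`. -/
theorem IsGate.mem_support (hr : IsGate C r) {x y : V} (q : G.Walk x y) (h : r x ≠ r y) :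
    r x ∈ q.support := by
  induction q with
  | nil => exact absurd rfl h
  | @cons a b d hab q ih =>
    by_cases hC : C.Adj a b
    · rw [hr.self a (C.edge_vert hC)]
      simp
    · have hab' := hr.eq_of_adj a b hab hC
      rw [hab'] at h ⊢
      rw [Walk.support_cons]
      exact List.mem_cons_of_mem _ (ih h)

theorem dist_eq_add_of_forall_mem_support (hG : G.Connected) {x y z : V}
    (h : ∀ q : G.Walk x y, z ∈ q.support) : G.dist x y = G.dist x z + G.dist z y := by
  classical
  refine le_antisymm hG.dist_triangle ?_
  obtain ⟨q, hq⟩ := hG.exists_walk_length_eq_dist x y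
  have h1 := dist_le (q.takeUntil z (h q))
  have h2 := dist_le (q.dropUntil z (h q))
  have h3 := congrArg Walk.length (q.take_spec (h q))
  rw [Walk.length_append] at h3
  omega

theorem IsGate.dist_eq (hr : IsGate C r) (hG : G.Connected) {x y : V} (h : r x ≠ r y) :
    G.dist x y = G.dist x (r x) + G.dist (r x) y :=
  dist_eq_add_of_forall_mem_support hG fun q => hr.mem_support q h

theorem IsGate.dist_eq_of_mem (hr : IsGate C r) (hG : G.Connected) (x : V) {y : V}
    (hy : y ∈ C.verts) : G.dist x y = G.dist x (r x) + G.dist (r x) y := by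
  by_cases h : r x = y
  · rw [h, dist_self, add_zero]
  · exact hr.dist_eq hG (by rwa [hr.self y hy])

theorem IsGate.eq_of_walk_disjoint (hr : IsGate C r) {x y : V} (q : G.Walk x y)
    (h : ∀ e ∈ q.edges, e ∉ C.edgeSet) : r x = r y := by
  induction q with
  | nil => rfl
  | @cons a b d hab q ih =>
    rw [Walk.edges_cons] at h
    exact (hr.eq_of_adj a b hab (h s(a, b) (by simp))).trans
      (ih fun e he => h e (List.mem_cons_of_mem _ he))

theorem gate_eq_of_mem_of_ne (hG : IsCactus G) {D : G.Subgraph} (hC : IsCycleOf C)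
    (hD : IsCycleOf D) (hCD : C ≠ D) {x y : V} (hx : x ∈ D.verts) (hy : y ∈ D.verts) :
    gate C x = gate C y := by
  classical
  obtain ⟨q, hq, rfl⟩ := hD.exists_walk hx
  rw [Walk.mem_verts_toSubgraph] at hy
  refine (isGate_gate hG hC).eq_of_walk_disjoint (q.takeUntil y hy) fun e he heC => ?_
  refine Set.disjoint_left.1 (hG.2 _ _ hC hD hCD) heC ?_
  rw [Walk.mem_edges_toSubgraph]
  exact q.edges_takeUntil_subset_edges hy he

end Gate

/-! ### Distances along a cycle -/

section CycleDist

variable {V : Type*} {G : SimpleGraph V} {v : V} {p : G.Walk v v} {r : V → V}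

/-- The distance of two positions on a cycle of length `L`. -/
def circDist (L i j : ℕ) : ℕ := min ((i - j) + (j - i)) (L - ((i - j) + (j - i)))

theorem le_add_dist (hG : G.Connected) {f : V → ℕ} (hf : ∀ x y, G.Adj x y → f x ≤ f y + 1)
    (x y : V) : f x ≤ f y + G.dist x y := by
  obtain ⟨q, hq⟩ := hG.exists_walk_length_eq_dist x y
  rw [← hq]
  clear hq
  induction q with
  | nil => simp
  | @cons a b d hab q ih =>
    have := hf a b hab
    rw [Walk.length_cons]
    omega

theorem dist_getVert_le (hG : G.Connected) {i j : ℕ} (hij : i ≤ j) (hj : j ≤ p.length) :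
    G.dist (p.getVert i) (p.getVert j) ≤ j - i := by
  induction j, hij using Nat.le_induction with
  | base => simp
  | succ n hn ih =>
    have h1 := ih (by omega)
    have h2 : G.dist (p.getVert n) (p.getVert (n + 1)) = 1 :=
      dist_eq_one_iff_adj.2 (p.adj_getVert_succ (by omega))
    have h3 := hG.dist_triangle (u := p.getVert i) (v := p.getVert n) (w := p.getVert (n + 1))
    omega

/-- The circular distance from the gate of `x` to position `j` is 1-Lipschitz in `x`: it is constant
across edges outside the cycle and changes by at most one along the cycle. So no shortcut exists. -/
theorem circDist_le_dist (hp : p.IsCycle) (hr : IsGate p.toSubgraph r) (hG : G.Connected)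
    {i j : ℕ} (hi : i < p.length) (hj : j < p.length) :
    circDist p.length i j ≤ G.dist (p.getVert i) (p.getVert j) := by
  have hL := hp.three_le_length
  choose idx hidx1 hidx2 using fun x => exists_getVert_of_mem hp (hr.mem x)
  have hself : ∀ k < p.length, idx (p.getVert k) = k := fun k hk =>
    getVert_injective_of_lt hp (hidx1 _) hk
      ((hidx2 _).trans (hr.self _ (getVert_mem_verts p k)))
  have key := le_add_dist hG (f := fun x => circDist p.length (idx x) j) ?_
    (p.getVert i) (p.getVert j)
  · simp only [hself i hi, hself j hj] at key
    unfold circDist at key ⊢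
    omega
  intro x y hxy
  have hstep : ∀ k < p.length, idx (p.getVert (k + 1)) = k + 1 ∨
      (k + 1 = p.length ∧ idx (p.getVert (k + 1)) = 0) := fun k hk => by
    by_cases hk' : k + 1 = p.length
    · right
      refine ⟨hk', ?_⟩
      have h0 := hself 0 (by omega)
      rwa [hk', Walk.getVert_length, ← p.getVert_zero]
    · exact Or.inl (hself _ (by omega))
  by_cases hC : p.toSubgraph.Adj x y
  · rw [Walk.toSubgraph_adj_iff] at hC
    obtain ⟨k, hk, hkL⟩ := hC
    have h1 := hself k hkL
    have h2 := hstep k hkL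
    rw [Sym2.eq_iff] at hk
    simp only [circDist]
    rcases hk with ⟨rfl, rfl⟩ | ⟨rfl, rfl⟩ <;> omega
  · have : idx x = idx y := getVert_injective_of_lt hp (hidx1 _) (hidx1 _)
      ((hidx2 x).trans ((hr.eq_of_adj x y hxy hC).trans (hidx2 y).symm))
    simp only [this]
    omega

theorem dist_getVert (hp : p.IsCycle) (hr : IsGate p.toSubgraph r) (hG : G.Connected)
    {i j : ℕ} (hi : i < p.length) (hj : j < p.length) :
    G.dist (p.getVert i) (p.getVert j) = circDist p.length i j := by
  refine le_antisymm ?_ (circDist_le_dist hp hr hG hi hj)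
  wlog hij : i ≤ j generalizing i j
  · have := this hj hi (by omega)
    rw [dist_comm] at this
    unfold circDist at this ⊢
    omega
  -- The direct arc, then the two pieces of the other arc, which passes through `v`, at once
  -- position `0` and position `p.length`.
  have h1 := dist_getVert_le (p := p) hG hij hj.le
  have h2 := dist_getVert_le (p := p) hG hj.le le_rfl
  have h3 := dist_getVert_le (p := p) hG (Nat.zero_le i) hi.le
  rw [Walk.getVert_length] at h2
  rw [p.getVert_zero] at h3
  have h4 := hG.dist_triangle (u := p.getVert j) (v := v) (w := p.getVert i)
  rw [dist_comm (u := p.getVert j) (v := p.getVert i)] at h4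
  unfold circDist
  omega

end CycleDist

/-! ### Branches at a vertex outside all cycles -/

section Branch

variable {V : Type*} {G : SimpleGraph V}

theorem exists_isCycleOf_of_walk {x z z' : V} (hz : G.Adj x z) (hz' : G.Adj x z') (hne : z ≠ z')
    (q : G.Walk z z') (hx : x ∉ q.support) : ∃ C : G.Subgraph, IsCycleOf C ∧ x ∈ C.verts := by
  classical
  have hb : x ∉ q.bypass.support := fun h => hx (q.support_bypass_subset_support h)
  refine ⟨_, ⟨x, Walk.cons hz (q.bypass.concat hz'.symm), ?_, rfl⟩, by simp⟩
  rw [Walk.cons_isCycle_iff]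
  refine ⟨q.bypass_isPath.concat hb _, fun h => ?_⟩
  rw [Walk.edges_concat, List.concat_eq_append, List.mem_append] at h
  rcases h with h | h
  · exact hb (Walk.fst_mem_support_of_mem_edges _ h)
  · rw [List.mem_singleton, Sym2.eq_iff] at h
    rcases h with ⟨rfl, -⟩ | ⟨-, h⟩
    · exact hz'.ne rfl
    · exact hne h

theorem exists_adj_ne (hl : ∀ v : V, ¬ IsLeaf G v) {u a : V} (h : G.Adj u a) :
    ∃ w, w ≠ a ∧ G.Adj u w := by
  by_contra! hcon
  refine hl u (Set.ncard_eq_one.2 ⟨a, ?_⟩)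
  ext w
  simp only [mem_neighborSet, Set.mem_singleton_iff]
  exact ⟨fun hw => by_contra fun hn => hcon w hn hw, fun hw => hw ▸ h⟩

/-- Take a longest path ending at `z` and avoiding `x`. Its first vertex is no leaf, so it has a
second neighbour, which lies on the path and closes a cycle; were it `x`, there would be a cycle
through `x`. -/
theorem exists_cycle_in_branch [Finite V] (hl : ∀ v : V, ¬ IsLeaf G v) {x z : V}
    (hxz : G.Adj x z) (hx : ∀ C : G.Subgraph, IsCycleOf C → x ∉ C.verts) :
    ∃ C : G.Subgraph, IsCycleOf C ∧ ∀ w ∈ C.verts, ∃ q : G.Walk w z, x ∉ q.support := by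
  classical
  have := Fintype.ofFinite V
  let P : ℕ → Prop := fun n => ∃ (u : V) (q : G.Walk u z), q.IsPath ∧ x ∉ q.support ∧ q.length = n
  have hP0 : P 0 := ⟨z, Walk.nil, by simp, by simpa using hxz.ne, rfl⟩
  obtain ⟨u, q, hq, hxq, hlen⟩ := Nat.findGreatest_spec (Nat.zero_le (Fintype.card V)) hP0
  have hmax : ∀ w, G.Adj w u → w ≠ x → w ∈ q.support := by
    intro w hw hwx
    by_contra hwq
    have hpath : (Walk.cons hw q).IsPath := hq.cons hwq
    have h1 : P (Walk.cons hw q).length :=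
      ⟨w, Walk.cons hw q, hpath, by simp [hwx.symm, hxq], rfl⟩
    have := Nat.le_findGreatest hpath.length_lt.le h1
    rw [Walk.length_cons, hlen] at this
    omega
  clear hlen
  cases q with
  | nil =>
    obtain ⟨w, hwx, hw⟩ := exists_adj_ne hl hxz.symm
    have := hmax w hw.symm hwx
    rw [Walk.support_nil, List.mem_singleton] at this
    exact absurd this hw.ne'
  | @cons _ a _ hua q =>
    rw [Walk.cons_isPath_iff] at hq
    obtain ⟨w, hwa, hw⟩ := exists_adj_ne hl hua
    by_cases hwx : w = x
    · subst hwx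
      obtain ⟨C, hC, hwC⟩ := exists_isCycleOf_of_walk hw.symm hxz
        (by rintro rfl; exact hq.2 q.end_mem_support) (Walk.cons hua q) hxq
      exact absurd hwC (hx C hC)
    have hwq := hmax w hw.symm hwx
    have hwq' : w ∈ q.support := by
      rw [Walk.support_cons, List.mem_cons] at hwq
      exact hwq.resolve_left hw.ne'
    have hsub : ∀ y ∈ (Walk.cons hw.symm (Walk.cons hua (q.takeUntil w hwq'))).support,
        y ∈ (Walk.cons hua q).support := by
      intro y hy
      rw [Walk.support_cons, Walk.support_cons, List.mem_cons, List.mem_cons] at hy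
      rw [Walk.support_cons, List.mem_cons]
      rcases hy with rfl | rfl | hy
      · exact Or.inr hwq'
      · exact Or.inl rfl
      · exact Or.inr (q.support_takeUntil_subset_support hwq' hy)
    refine ⟨_, ⟨w, Walk.cons hw.symm (Walk.cons hua (q.takeUntil w hwq')), ?_, rfl⟩, ?_⟩
    · rw [Walk.cons_isCycle_iff, Walk.cons_isPath_iff]
      have hu : u ∉ (q.takeUntil w hwq').support :=
        fun h => hq.2 (q.support_takeUntil_subset_support hwq' h)
      refine ⟨⟨hq.1.takeUntil hwq', hu⟩, fun h => ?_⟩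
      rw [Walk.edges_cons, List.mem_cons] at h
      rcases h with h | h
      · rw [Sym2.eq_iff] at h
        rcases h with ⟨h, -⟩ | ⟨h, -⟩
        · exact hw.ne' h
        · exact hwa h
      · exact hu (Walk.snd_mem_support_of_mem_edges _ h)
    · intro y hy
      rw [Walk.mem_verts_toSubgraph] at hy
      have hy' := hsub y hy
      exact ⟨(Walk.cons hua q).dropUntil y hy',
        fun h => hxq (Walk.support_dropUntil_subset_support _ hy' h)⟩

end Branch

/-! ### A sufficient condition for a metric generator -/

section Criterion

variable {V : Type*} {G : SimpleGraph V} {S : Finset V} {C : G.Subgraph}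

/-- The set `S` distinguishes every two vertices of `C`. -/
def ResolvesCycle (S : Finset V) (C : G.Subgraph) : Prop :=
  ∀ x ∈ C.verts, ∀ y ∈ C.verts, x ≠ y → ∃ s ∈ S, G.dist s x ≠ G.dist s y

/-- For no vertex `x ≠ v` of `C` does `v` lie between `x` and all the vertices of `S`. -/
def SurroundsAt (S : Finset V) (C : G.Subgraph) (v : V) : Prop :=
  ∀ x ∈ C.verts, x ≠ v → ∃ s ∈ S, G.dist s x ≠ G.dist s v + G.dist v x

theorem exists_two_adj_of_mem (hC : IsCycleOf C) {a : V} (ha : a ∈ C.verts) :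
    ∃ x ∈ C.verts, ∃ y ∈ C.verts, x ≠ y ∧ G.Adj a x ∧ G.Adj a y := by
  obtain ⟨p, hp, rfl⟩ := hC.exists_walk ha
  have hL := hp.three_le_length
  refine ⟨_, getVert_mem_verts p 1, _, getVert_mem_verts p (p.length - 1), fun h => ?_, ?_, ?_⟩
  · have := getVert_injective_of_lt hp (by omega) (by omega) h
    omega
  · simpa using p.adj_getVert_succ (i := 0) (by omega)
  · have := p.adj_getVert_succ (i := p.length - 1) (by omega)
    rw [Nat.sub_add_cancel (by omega), Walk.getVert_length] at this
    exact this.symm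

/-- Landmarks with gate `a` cannot tell apart the two neighbours of `a` on `C`. -/
theorem ResolvesCycle.exists_gate_ne (hS : ResolvesCycle S C) (hG : IsCactus G)
    (hC : IsCycleOf C) {a : V} (ha : a ∈ C.verts) : ∃ s ∈ S, gate C s ≠ a := by
  obtain ⟨x, hx, y, hy, hxy, hax, hay⟩ := exists_two_adj_of_mem hC ha
  obtain ⟨s, hs, hne⟩ := hS x hx y hy hxy
  refine ⟨s, hs, fun h => hne ?_⟩
  have hr := isGate_gate hG hC
  rw [hr.dist_eq_of_mem hG.1 s hx, hr.dist_eq_of_mem hG.1 s hy, h, dist_eq_one_iff_adj.2 hax,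
    dist_eq_one_iff_adj.2 hay]

/-- A branch at `x` not leading to `y` contains a cycle, and that cycle forces a landmark into the
branch. A walk from there to `y` avoiding `x` would create a cycle through `x`. -/
theorem exists_dist_eq_add_of_forall_notMem [Finite V] (hG : IsCactus G)
    (hl : ∀ v : V, ¬ IsLeaf G v) (hS : ∀ C : G.Subgraph, IsCycleOf C → ResolvesCycle S C)
    {x y : V} (hxy : x ≠ y) (hx : ∀ C : G.Subgraph, IsCycleOf C → x ∉ C.verts) :
    ∃ s ∈ S, G.dist s y = G.dist s x + G.dist x y := by
  classical
  obtain ⟨q, hq⟩ := (hG.1.preconnected x y).exists_isPath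
  cases q with
  | nil => exact absurd rfl hxy
  | @cons _ z' _ hz' q =>
    rw [Walk.cons_isPath_iff] at hq
    obtain ⟨z, hzz', hz⟩ := exists_adj_ne hl hz'
    obtain ⟨C, hC, hCz⟩ := exists_cycle_in_branch hl hz hx
    have hr := isGate_gate hG hC
    obtain ⟨s, hs, hsx⟩ := (hS C hC).exists_gate_ne hG hC (hr.mem x)
    refine ⟨s, hs, dist_eq_add_of_forall_mem_support hG.1 fun t => ?_⟩
    by_contra ht
    have hw : ∃ w : G.Walk s (gate C s), x ∉ w.support := by
      obtain ⟨w, hw⟩ := hG.1.exists_walk_length_eq_dist s (gate C s)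
      refine ⟨w, fun hxw => ?_⟩
      have h1 := dist_le (w.takeUntil x hxw)
      have h2 := dist_le (w.dropUntil x hxw)
      have h3 := congrArg Walk.length (w.take_spec hxw)
      rw [Walk.length_append] at h3
      have h4 := hr.dist_eq hG.1 hsx
      have h5 : G.dist x (gate C s) ≠ 0 := by
        rw [Ne, hG.1.dist_eq_zero_iff]
        intro h
        exact hx C hC (h ▸ hr.mem s)
      rw [dist_comm (u := x)] at h2 h5
      omega
    obtain ⟨w, hw⟩ := hw
    obtain ⟨w', hw'⟩ := hCz _ (hr.mem s)
    obtain ⟨C', hC', hxC'⟩ := exists_isCycleOf_of_walk hz hz' hzz'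
      (((w'.reverse.append w.reverse).append t).append q.reverse) (by
        simp only [Walk.mem_support_append_iff, Walk.support_reverse, List.mem_reverse]
        tauto)
    exact hx C' hC' hxC'

theorem isMetricGenerator_of_resolvesCycle [Finite V] (hG : IsCactus G)
    (hl : ∀ v : V, ¬ IsLeaf G v) (hS : ∀ C : G.Subgraph, IsCycleOf C → ResolvesCycle S C)
    (hS' : ∀ C D : G.Subgraph, IsCycleOf C → IsCycleOf D → C ≠ D →
      ∀ v ∈ C.verts, v ∈ D.verts → SurroundsAt S C v ∨ SurroundsAt S D v) :
    IsMetricGenerator G S := by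
  intro x y hxy
  by_contra! hcon
  have hc := hG.1
  -- Otherwise some landmark `s` has `x` between itself and `y`, so `s` distinguishes them.
  have hcyc : ∀ x y : V, x ≠ y → (∀ s ∈ S, G.dist s x = G.dist s y) →
      ∃ C : G.Subgraph, IsCycleOf C ∧ x ∈ C.verts ∧ gate C y ≠ x := by
    intro x y hxy hcon
    have hpos : G.dist x y ≠ 0 := by rwa [Ne, hc.dist_eq_zero_iff]
    by_contra! hno
    by_cases hx : ∀ C : G.Subgraph, IsCycleOf C → x ∉ C.verts
    · obtain ⟨s, hs, h⟩ := exists_dist_eq_add_of_forall_notMem hG hl hS hxy hx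
      have := hcon s hs
      omega
    · push Not at hx
      obtain ⟨C, hC, hxC⟩ := hx
      obtain ⟨s, hs, hsx⟩ := (hS C hC).exists_gate_ne hG hC hxC
      have hr := isGate_gate hG hC
      have hy := hno C hC hxC
      have h := hr.dist_eq hc (x := y) (y := s) (by rw [hy]; exact hsx.symm)
      have := hcon s hs
      rw [hy, dist_comm (u := y) (v := s), dist_comm (u := y) (v := x),
        dist_comm (u := x) (v := s)] at h
      omega
  obtain ⟨C, hC, hxC, hvx⟩ := hcyc x y hxy hcon
  obtain ⟨D, hD, hyD, hwy⟩ := hcyc y x hxy.symm fun s hs => (hcon s hs).symm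
  have hrC := isGate_gate hG hC
  have hrD := isGate_gate hG hD
  by_cases hCD : C = D
  · subst hCD
    obtain ⟨s, hs, h⟩ := hS C hC x hxC y hyD hxy
    exact h (hcon s hs)
  have hxy1 := hrC.dist_eq_of_mem hc y hxC
  have hxy2 := hrD.dist_eq_of_mem hc x hyD
  have hwv := gate_eq_of_mem_of_ne hG hC hD hCD (hrD.mem x) hyD
  have hwx := hrC.dist_eq_of_mem hc (gate D x) hxC
  rw [hwv] at hwx
  have hkey : ∀ s ∈ S, gate C s ≠ gate C y →
      G.dist s x = G.dist s (gate C y) + G.dist (gate C y) y := by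
    intro s hs hne
    have := hrC.dist_eq hc (x := y) (y := s) hne.symm
    rw [hcon s hs]
    rw [dist_comm (u := y) (v := s), dist_comm (u := y), dist_comm (v := s)] at this
    omega
  have hkey' : ∀ s ∈ S, gate D s ≠ gate D x →
      G.dist s y = G.dist s (gate D x) + G.dist (gate D x) x := by
    intro s hs hne
    have := hrD.dist_eq hc (x := x) (y := s) hne.symm
    rw [← hcon s hs]
    rw [dist_comm (u := x) (v := s), dist_comm (u := x), dist_comm (v := s)] at this
    omega
  have hle : G.dist (gate C y) y ≤ G.dist (gate C y) x := by
    obtain ⟨s, hs, hne⟩ := (hS C hC).exists_gate_ne hG hC (hrC.mem y)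
    have h1 := hkey s hs hne
    have h2 := hc.dist_triangle (u := s) (v := gate C y) (w := x)
    omega
  have hle' : G.dist (gate D x) x ≤ G.dist (gate D x) y := by
    obtain ⟨s, hs, hne⟩ := (hS D hD).exists_gate_ne hG hD (hrD.mem x)
    have h1 := hkey' s hs hne
    have h2 := hc.dist_triangle (u := s) (v := gate D x) (w := y)
    omega
  rw [dist_comm (u := y) (v := x), dist_comm (u := y) (v := gate C y)] at hxy1
  rw [dist_comm (u := x) (v := gate D x)] at hxy2
  -- With `v = gate C y` and `w = gate D x`, the two inequalities and the gate decompositions give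
  -- `2 * d(v, w) ≤ 0`. Then `x` and `y` are equidistant from the common vertex `v`, which lies
  -- between every landmark and each of them.
  have hvw : gate D x = gate C y := by
    rw [← hc.dist_eq_zero_iff]
    omega
  rw [hvw] at hle' hkey' hxy2
  have heq : G.dist (gate C y) x = G.dist (gate C y) y := by omega
  rcases hS' C D hC hD hCD (gate C y) (hrC.mem y) (hvw ▸ hrD.mem x) with h | h
  · obtain ⟨s, hs, h⟩ := h x hxC hvx.symm
    refine h ?_
    by_cases hne : gate C s = gate C y
    · rw [hrC.dist_eq_of_mem hc s hxC, hne]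
    · rw [hkey s hs hne, heq]
  · obtain ⟨s, hs, h⟩ := h y hyD (hvw ▸ hwy.symm)
    refine h ?_
    by_cases hne : gate D s = gate D x
    · rw [hrD.dist_eq_of_mem hc s hyD, hne, hvw]
    · rw [hkey' s hs (hvw ▸ hne), heq]

end Criterion

/-! ### Selecting vertices of one cycle -/

section Select

variable {V : Type*} {G : SimpleGraph V} {S : Finset V} {C : G.Subgraph}

/-- The distance to `0` determines a position up to the reflection fixing `0`; the distance to `k`
breaks this symmetry unless `k` is fixed by it. -/
theorem eq_of_circDist_zero {L k a b : ℕ} (ha : a < L) (hb : b < L) (hk : k < L) (hk0 : k ≠ 0)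
    (hk2 : 2 * k ≠ L) (h0 : circDist L 0 a = circDist L 0 b)
    (h1 : circDist L k a = circDist L k b) : a = b := by
  unfold circDist at h0 h1
  omega

/-- With `h = L / 2`, the sum of the distances to the two anchors is always `h` or `h + 1`, whereas
adding the hypotheses makes the sums at `i` and `j` differ by `2 * circDist L i j`. -/
theorem eq_of_circDist_half {L i j : ℕ} (hL : 3 ≤ L) (hi : i < L) (hj : j < L)
    (h1 : circDist L 1 j = circDist L 1 i + circDist L i j)
    (h2 : circDist L (1 + L / 2) j = circDist L (1 + L / 2) i + circDist L i j) : j = i := by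
  unfold circDist at h1 h2
  obtain ⟨h, hh⟩ : ∃ h, L / 2 = h := ⟨_, rfl⟩
  rw [hh] at h2
  have hh' : L = 2 * h ∨ L = 2 * h + 1 := by omega
  clear hh
  rcases hh' with rfl | rfl <;> rcases le_total i 1 with a | a <;> rcases le_total j 1 with b | b <;>
    rcases le_total i (1 + h) with c | c <;> rcases le_total j (1 + h) with d | d <;>
    rcases le_total i j with e | e <;>
    simp only [Nat.sub_eq_zero_of_le, a, b, c, d, e, zero_add, add_zero] at h1 h2 <;>
    omega

theorem eq_zero_of_circDist_half {L j : ℕ} (hj : j < L)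
    (h : circDist L (L / 2) j = circDist L (L / 2) 0 + circDist L 0 j) : j = 0 := by
  unfold circDist at h
  omega

theorem resolvesCycle_of_gate (hG : IsCactus G) (hC : IsCycleOf C)
    (h : ∀ x ∈ C.verts, ∀ y ∈ C.verts,
      (∀ s ∈ S, G.dist (gate C s) x = G.dist (gate C s) y) → x = y) : ResolvesCycle S C := by
  intro x hx y hy hxy
  by_contra! hcon
  refine hxy (h x hx y hy fun s hs => ?_)
  have h1 := (isGate_gate hG hC).dist_eq_of_mem hG.1 s hx
  have h2 := (isGate_gate hG hC).dist_eq_of_mem hG.1 s hy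
  have h3 := hcon s hs
  omega

theorem surroundsAt_of_gate (hG : IsCactus G) (hC : IsCycleOf C) {v : V} (hv : v ∈ C.verts)
    (h : ∀ x ∈ C.verts,
      (∀ s ∈ S, G.dist (gate C s) x = G.dist (gate C s) v + G.dist v x) → x = v) :
    SurroundsAt S C v := by
  intro x hx hxv
  by_contra! hcon
  refine hxv (h x hx fun s hs => ?_)
  have h1 := (isGate_gate hG hC).dist_eq_of_mem hG.1 s hx
  have h2 := (isGate_gate hG hC).dist_eq_of_mem hG.1 s hv
  have h3 := hcon s hs
  omega

theorem dist_getVert_of_isCactus (hG : IsCactus G) {v : V} {p : G.Walk v v} (hp : p.IsCycle)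
    {i j : ℕ} (hi : i < p.length) (hj : j < p.length) :
    G.dist (p.getVert i) (p.getVert j) = circDist p.length i j :=
  dist_getVert hp (isGate_gate hG ⟨v, p, hp, rfl⟩) hG.1 hi hj

theorem gate_getVert (hG : IsCactus G) {v : V} {p : G.Walk v v} (hp : p.IsCycle) (i : ℕ) :
    gate p.toSubgraph (p.getVert i) = p.getVert i :=
  (isGate_gate hG ⟨v, p, hp, rfl⟩).self _ (getVert_mem_verts p i)

/-- Two vertices whose gates on a cycle are distinct and not antipodal resolve the cycle. -/
theorem resolvesCycle_of_two_gates (hG : IsCactus G) {v : V} {p : G.Walk v v} (hp : p.IsCycle)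
    {k : ℕ} (hk : k < p.length) (hk0 : k ≠ 0) (hk2 : 2 * k ≠ p.length) {z s : V} (hz : z ∈ S)
    (hzv : gate p.toSubgraph z = v) (hs : s ∈ S) (hsk : gate p.toSubgraph s = p.getVert k) :
    ResolvesCycle S p.toSubgraph := by
  have hL := hp.three_le_length
  refine resolvesCycle_of_gate hG ⟨v, p, hp, rfl⟩ fun x hx y hy h => ?_
  obtain ⟨a, ha, rfl⟩ := exists_getVert_of_mem hp hx
  obtain ⟨b, hb, rfl⟩ := exists_getVert_of_mem hp hy
  have h0 := h z hz
  have h1 := h s hs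
  rw [hzv] at h0
  conv at h0 => congr <;> (arg 2; rw [← p.getVert_zero])
  rw [hsk] at h1
  rw [dist_getVert_of_isCactus hG hp (by omega) (by omega),
    dist_getVert_of_isCactus hG hp (by omega) (by omega)] at h0 h1
  rw [eq_of_circDist_zero ha hb hk hk0 hk2 h0 h1]

/-- A vertex whose gate on a cycle is opposite to `v` prevents `v` from being one-sided. -/
theorem surroundsAt_of_gate_eq_half (hG : IsCactus G) {v : V} {p : G.Walk v v} (hp : p.IsCycle)
    {s : V} (hs : s ∈ S) (hsk : gate p.toSubgraph s = p.getVert (p.length / 2)) :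
    SurroundsAt S p.toSubgraph v := by
  have hL := hp.three_le_length
  refine surroundsAt_of_gate hG ⟨v, p, hp, rfl⟩ (by simp) fun x hx h => ?_
  obtain ⟨j, hj, rfl⟩ := exists_getVert_of_mem hp hx
  have h1 := h s hs
  have e0 := dist_getVert_of_isCactus hG hp (i := 0) (j := j) (by omega) hj
  have e1 := dist_getVert_of_isCactus hG hp (i := p.length / 2) (j := 0) (by omega) (by omega)
  rw [hsk, dist_getVert_of_isCactus hG hp (by omega) hj] at h1
  rw [p.getVert_zero] at e0 e1
  rw [e0, e1] at h1
  rw [eq_zero_of_circDist_half hj h1, p.getVert_zero]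

theorem exists_pair_resolving_surrounding (hG : IsCactus G) (hC : IsCycleOf C) {v₀ : V}
    (hv₀ : v₀ ∈ C.verts) : ∃ T : Finset V, (∀ t ∈ T, t ∈ C.verts) ∧ T.Nonempty ∧ T.card ≤ 2 ∧
      ∀ S : Finset V, T ⊆ S → (∃ z ∈ S, gate C z = v₀) →
        ResolvesCycle S C ∧ ∀ v ∈ C.verts, SurroundsAt S C v := by
  classical
  obtain ⟨p, hp, rfl⟩ := hC.exists_walk hv₀
  have hL := hp.three_le_length
  -- Position `0` is already represented by `z`. Position `1` resolves the cycle together with it,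
  -- and the two nearly antipodal vertices surround every vertex.
  refine ⟨{p.getVert 1, p.getVert (1 + p.length / 2)}, ?_, by simp, Finset.card_le_two, ?_⟩
  · intro t ht
    rw [Finset.mem_insert, Finset.mem_singleton] at ht
    rcases ht with rfl | rfl <;> exact getVert_mem_verts p _
  rintro S hTS ⟨z, hz, hzv⟩
  have hs : p.getVert 1 ∈ S := hTS (by simp)
  have ht : p.getVert (1 + p.length / 2) ∈ S := hTS (by simp)
  refine ⟨resolvesCycle_of_two_gates hG hp (by omega) one_ne_zero (by omega) hz hzv hs
    (gate_getVert hG hp 1), fun v hv => surroundsAt_of_gate hG hC hv fun x hx h => ?_⟩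
  obtain ⟨i, hi, rfl⟩ := exists_getVert_of_mem hp hv
  obtain ⟨j, hj, rfl⟩ := exists_getVert_of_mem hp hx
  have h1 := h _ hs
  have h2 := h _ ht
  rw [gate_getVert hG hp, dist_getVert_of_isCactus hG hp (by omega) (by omega),
    dist_getVert_of_isCactus hG hp (by omega) (by omega),
    dist_getVert_of_isCactus hG hp (by omega) (by omega)] at h1 h2
  rw [eq_of_circDist_half hL hi hj h1 h2]

theorem exists_singleton_resolving (hG : IsCactus G) (hC : IsCycleOf C) {v₀ : V}
    (hv₀ : v₀ ∈ C.verts) : ∃ t ∈ C.verts, ∀ S : Finset V, t ∈ S → (∃ z ∈ S, gate C z = v₀) →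
      ResolvesCycle S C := by
  obtain ⟨p, hp, rfl⟩ := hC.exists_walk hv₀
  have hL := hp.three_le_length
  refine ⟨p.getVert 1, getVert_mem_verts p 1, ?_⟩
  rintro S hs ⟨z, hz, hzv⟩
  exact resolvesCycle_of_two_gates hG hp (by omega) one_ne_zero (by omega) hz hzv hs
    (gate_getVert hG hp 1)

/-- On an odd cycle a vertex farthest from `v₀` is not antipodal to it, so the same vertex both
resolves and surrounds. -/
theorem exists_singleton_of_odd (hG : IsCactus G) (hC : IsCycleOf C)
    (hodd : Odd C.edgeSet.ncard) {v₀ : V} (hv₀ : v₀ ∈ C.verts) :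
    ∃ t ∈ C.verts, ∀ S : Finset V, t ∈ S → (∃ z ∈ S, gate C z = v₀) →
      ResolvesCycle S C ∧ SurroundsAt S C v₀ := by
  obtain ⟨p, hp, rfl⟩ := hC.exists_walk hv₀
  have hL := hp.three_le_length
  rw [ncard_edgeSet_toSubgraph hp] at hodd
  obtain ⟨h, hh⟩ := hodd
  refine ⟨p.getVert (p.length / 2), getVert_mem_verts p _, ?_⟩
  rintro S hs ⟨z, hz, hzv⟩
  exact ⟨resolvesCycle_of_two_gates hG hp (by omega) (by omega) (by omega) hz hzv hs
    (gate_getVert hG hp _), surroundsAt_of_gate_eq_half hG hp hs (gate_getVert hG hp _)⟩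

/-- The free landmark at `u` does one of the two jobs: it surrounds `v₀` if antipodal to it and
otherwise resolves `C`. The new vertex `t` does the other. -/
theorem exists_singleton_of_two_gates (hG : IsCactus G) (hC : IsCycleOf C) {v₀ u : V}
    (hv₀ : v₀ ∈ C.verts) (hu : u ∈ C.verts) (huv : u ≠ v₀) :
    ∃ t ∈ C.verts, ∀ S : Finset V, t ∈ S → (∃ z ∈ S, gate C z = v₀) → (∃ z ∈ S, gate C z = u) →
      ResolvesCycle S C ∧ SurroundsAt S C v₀ := by
  obtain ⟨p, hp, rfl⟩ := hC.exists_walk hv₀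
  have hL := hp.three_le_length
  obtain ⟨m, hm, rfl⟩ := exists_getVert_of_mem hp hu
  have hm0 : m ≠ 0 := by
    rintro rfl
    exact huv p.getVert_zero
  by_cases hm2 : 2 * m = p.length
  · refine ⟨p.getVert 1, getVert_mem_verts p 1, ?_⟩
    rintro S hs ⟨z, hz, hzv⟩ ⟨z', hz', hzu⟩
    refine ⟨resolvesCycle_of_two_gates hG hp (by omega) one_ne_zero (by omega) hz hzv hs
      (gate_getVert hG hp 1), surroundsAt_of_gate_eq_half hG hp hz' ?_⟩
    rw [hzu, ← hm2, Nat.mul_div_cancel_left _ two_pos]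
  · refine ⟨p.getVert (p.length / 2), getVert_mem_verts p _, ?_⟩
    rintro S hs ⟨z, hz, hzv⟩ ⟨z', hz', hzu⟩
    exact ⟨resolvesCycle_of_two_gates hG hp hm hm0 hm2 hz hzv hz' hzu,
      surroundsAt_of_gate_eq_half hG hp hs (gate_getVert hG hp _)⟩

end Select

/-! ### Upper bounds -/

section Upper

variable {V : Type*} {G : SimpleGraph V}

theorem exists_ne_of_two_le_numCycles (hc : 2 ≤ numCycles G) {C : G.Subgraph} :
    ∃ D : G.Subgraph, IsCycleOf D ∧ D ≠ C := by
  obtain ⟨D, hD, hne⟩ := Set.exists_ne_of_one_lt_ncard (s := {C : G.Subgraph | IsCycleOf C}) hc C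
  exact ⟨D, hD, hne⟩

theorem exists_gate_eq (hG : IsCactus G) {S : Finset V}
    (hS : ∀ D : G.Subgraph, IsCycleOf D → ∃ z ∈ S, z ∈ D.verts) {C D : G.Subgraph}
    (hC : IsCycleOf C) (hD : IsCycleOf D) (hCD : C ≠ D) {w : V} (hw : w ∈ D.verts) :
    ∃ z ∈ S, gate C z = gate C w := by
  obtain ⟨z, hz, hzD⟩ := hS D hD
  exact ⟨z, hz, gate_eq_of_mem_of_ne hG hC hD hCD hzD hw⟩

theorem exists_gate_eq_of_mem (hG : IsCactus G) {S : Finset V}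
    (hS : ∀ D : G.Subgraph, IsCycleOf D → ∃ z ∈ S, z ∈ D.verts) {C D : G.Subgraph}
    (hC : IsCycleOf C) (hD : IsCycleOf D) (hCD : C ≠ D) {w : V} (hwC : w ∈ C.verts)
    (hw : w ∈ D.verts) : ∃ z ∈ S, gate C z = w := by
  obtain ⟨z, hz, h⟩ := exists_gate_eq hG hS hC hD hCD hw
  exact ⟨z, hz, h.trans ((isGate_gate hG hC).self w hwC)⟩

theorem eq_of_mem_of_mem (hG : IsCactus G) {C D : G.Subgraph} (hC : IsCycleOf C)
    (hD : IsCycleOf D) (hCD : C ≠ D) {u v : V} (huC : u ∈ C.verts) (huD : u ∈ D.verts)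
    (hvC : v ∈ C.verts) (hvD : v ∈ D.verts) : u = v := by
  have hr := isGate_gate hG hC
  rw [← hr.self u huC, ← hr.self v hvC]
  exact gate_eq_of_mem_of_ne hG hC hD hCD huD hvD

/-- Counting scheme for all upper bounds: cycles in `Z` receive one vertex, the others two. Pairs of
cycles not both in `Z` are surrounded automatically. -/
theorem metricDim_add_card_le [Finite V] (hG : IsCactus G) (hl : ∀ v : V, ¬ IsLeaf G v)
    (hc : 2 ≤ numCycles G) (Z : Finset G.Subgraph) (hZ : ∀ C ∈ Z, IsCycleOf C)
    (t : G.Subgraph → V) (ht : ∀ C ∈ Z, t C ∈ C.verts)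
    (hS : ∀ S : Finset V, (∀ C ∈ Z, t C ∈ S) →
      (∀ D : G.Subgraph, IsCycleOf D → ∃ z ∈ S, z ∈ D.verts) →
      (∀ C ∈ Z, ResolvesCycle S C) ∧ ∀ C ∈ Z, ∀ D ∈ Z, C ≠ D →
        ∀ v ∈ C.verts, v ∈ D.verts → SurroundsAt S C v ∨ SurroundsAt S D v) :
    metricDim G + Z.card ≤ 2 * numCycles G := by
  classical
  -- `ncard` is `0` on infinite sets, so `hc` already gives finiteness.
  have hfin : {C : G.Subgraph | IsCycleOf C}.Finite :=
    Set.finite_of_ncard_ne_zero (by unfold numCycles at hc; omega)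
  set F := hfin.toFinset with hF
  have hmem : ∀ C, C ∈ F ↔ IsCycleOf C := fun C => by simp [hF]
  have hcard : numCycles G = F.card := Set.ncard_eq_toFinset_card _ hfin
  have hpair : ∀ C : G.Subgraph, ∃ T : Finset V, IsCycleOf C → ((∀ t ∈ T, t ∈ C.verts) ∧
      T.Nonempty ∧ T.card ≤ 2 ∧ ∀ S : Finset V, T ⊆ S →
        (∀ D : G.Subgraph, IsCycleOf D → ∃ z ∈ S, z ∈ D.verts) →
        ResolvesCycle S C ∧ ∀ v ∈ C.verts, SurroundsAt S C v) := by
    intro C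
    by_cases hC : IsCycleOf C
    · obtain ⟨D, hD, hDC⟩ := exists_ne_of_two_le_numCycles hc (C := C)
      obtain ⟨w, hw⟩ := hD.nonempty
      obtain ⟨T, h1, h2, h3, h4⟩ :=
        exists_pair_resolving_surrounding hG hC ((isGate_gate hG hC).mem w)
      exact ⟨T, fun _ => ⟨h1, h2, h3, fun S hTS hS =>
        h4 S hTS (exists_gate_eq hG hS hC hD hDC.symm hw)⟩⟩
    · exact ⟨∅, fun h => absurd h hC⟩
  choose T hT using hpair
  let U : G.Subgraph → Finset V := fun C => if C ∈ Z then {t C} else T C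
  have hUne : ∀ C, IsCycleOf C → ∃ z ∈ U C, z ∈ C.verts := by
    intro C hC
    by_cases hCZ : C ∈ Z
    · exact ⟨t C, by simp [U, hCZ], ht C hCZ⟩
    · obtain ⟨z, hz⟩ := (hT C hC).2.1
      exact ⟨z, by simpa [U, hCZ] using hz, (hT C hC).1 z hz⟩
  have hUS : ∀ C, IsCycleOf C → U C ⊆ F.biUnion U := fun C hC =>
    Finset.subset_biUnion_of_mem U ((hmem C).2 hC)
  have hmeet : ∀ D : G.Subgraph, IsCycleOf D → ∃ z ∈ F.biUnion U, z ∈ D.verts := fun D hD => by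
    obtain ⟨z, hz, hzD⟩ := hUne D hD
    exact ⟨z, hUS D hD hz, hzD⟩
  obtain ⟨hZ1, hZ2⟩ := hS (F.biUnion U)
    (fun C hC => hUS C (hZ C hC) (by simp [U, hC])) hmeet
  have hT' : ∀ C, IsCycleOf C → C ∉ Z → ResolvesCycle (F.biUnion U) C ∧
      ∀ v ∈ C.verts, SurroundsAt (F.biUnion U) C v := fun C hC hCZ =>
    (hT C hC).2.2.2 _ (by simpa [U, hCZ] using hUS C hC) hmeet
  have hgen : IsMetricGenerator G (F.biUnion U) := by
    refine isMetricGenerator_of_resolvesCycle hG hl (fun C hC => ?_)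
      fun C D hC hD hCD v hvC hvD => ?_
    · by_cases hCZ : C ∈ Z
      · exact hZ1 C hCZ
      · exact (hT' C hC hCZ).1
    · by_cases hCZ : C ∈ Z
      · by_cases hDZ : D ∈ Z
        · exact hZ2 C hCZ D hDZ hCD v hvC hvD
        · exact Or.inr ((hT' D hD hDZ).2 v hvD)
      · exact Or.inl ((hT' C hC hCZ).2 v hvC)
  have h1 : metricDim G ≤ (F.biUnion U).card := Nat.sInf_le ⟨_, hgen, rfl⟩
  have h2 : (F.biUnion U).card ≤ ∑ C ∈ F, (U C).card := Finset.card_biUnion_le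
  have h3 : ∑ C ∈ F, (U C).card + Z.card ≤ 2 * F.card := by
    have hZF : Z ⊆ F := fun C hC => (hmem C).2 (hZ C hC)
    have hZc : Z.card = ∑ C ∈ F, if C ∈ Z then 1 else 0 := by
      rw [← Finset.card_filter, Finset.filter_mem_eq_inter, Finset.inter_eq_right.2 hZF]
    rw [hZc, ← Finset.sum_add_distrib, mul_comm, ← smul_eq_mul]
    refine Finset.sum_le_card_nsmul _ _ _ fun C hC => ?_
    by_cases hCZ : C ∈ Z
    · simp [U, hCZ]
    · simpa [U, hCZ] using (hT C ((hmem C).1 hC)).2.2.1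
  omega

theorem metricDim_add_one_le [Finite V] (hG : IsCactus G) (hl : ∀ v : V, ¬ IsLeaf G v)
    (hc : 2 ≤ numCycles G) : metricDim G + 1 ≤ 2 * numCycles G := by
  classical
  -- `⊥` is a dummy; only some cycle is wanted.
  obtain ⟨C, hC, -⟩ := exists_ne_of_two_le_numCycles hc (C := ⊥)
  obtain ⟨D, hD, hDC⟩ := exists_ne_of_two_le_numCycles hc (C := C)
  obtain ⟨w, hw⟩ := hD.nonempty
  obtain ⟨t, ht, hS⟩ := exists_singleton_resolving hG hC ((isGate_gate hG hC).mem w)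
  refine metricDim_add_card_le hG hl hc {C} (by simpa using hC) (fun _ => t) (by simpa using ht)
    fun S htS hm => ⟨?_, ?_⟩
  · simp only [Finset.mem_singleton, forall_eq] at htS ⊢
    exact hS S htS (exists_gate_eq hG hm hC hD hDC.symm hw)
  · simp only [Finset.mem_singleton]
    rintro _ rfl _ rfl h
    exact absurd rfl h

theorem metricDim_add_two_le_of_pair [Finite V] (hG : IsCactus G) (hl : ∀ v : V, ¬ IsLeaf G v)
    (hc : 2 ≤ numCycles G) {C D : G.Subgraph} (hC : IsCycleOf C) (hD : IsCycleOf D)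
    (hCD : C ≠ D) {t : V} (ht : t ∈ C.verts)
    (hS : ∀ S : Finset V, t ∈ S → (∀ D : G.Subgraph, IsCycleOf D → ∃ z ∈ S, z ∈ D.verts) →
      ResolvesCycle S C ∧ ∀ v ∈ C.verts, v ∈ D.verts → SurroundsAt S C v) :
    metricDim G + 2 ≤ 2 * numCycles G := by
  classical
  obtain ⟨w, hw⟩ := hC.nonempty
  obtain ⟨t', ht', hS'⟩ := exists_singleton_resolving hG hD ((isGate_gate hG hD).mem w)
  suffices metricDim G + ({C, D} : Finset G.Subgraph).card ≤ 2 * numCycles G by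
    rwa [Finset.card_pair hCD] at this
  refine metricDim_add_card_le hG hl hc {C, D} ?_ (fun B => if B = C then t else t') ?_
    fun S htS hm => ?_
  · simp [hC, hD]
  · simp [ht, ht', hCD.symm]
  · simp only [Finset.mem_insert, Finset.mem_singleton, forall_eq_or_imp, forall_eq, if_true,
      hCD.symm, if_false] at htS
    obtain ⟨h1, h2⟩ := hS S htS.1 hm
    refine ⟨?_, ?_⟩
    · simp only [Finset.mem_insert, Finset.mem_singleton, forall_eq_or_imp, forall_eq]
      exact ⟨h1, hS' S htS.2 (exists_gate_eq hG hm hD hC hCD.symm hw)⟩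
    · simp only [Finset.mem_insert, Finset.mem_singleton]
      rintro A (rfl | rfl) B (rfl | rfl) hAB v hvA hvB
      · exact absurd rfl hAB
      · exact Or.inl (h2 v hvA hvB)
      · exact Or.inr (h2 v hvB hvA)
      · exact absurd rfl hAB

theorem metricDim_add_two_le_of_disjoint [Finite V] (hG : IsCactus G)
    (hl : ∀ v : V, ¬ IsLeaf G v) (hc : 2 ≤ numCycles G) {C D : G.Subgraph} (hC : IsCycleOf C)
    (hD : IsCycleOf D) (hCD : ∀ v ∈ C.verts, v ∉ D.verts) :
    metricDim G + 2 ≤ 2 * numCycles G := by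
  obtain ⟨w, hw⟩ := hD.nonempty
  have hne : C ≠ D := by
    rintro rfl
    exact hCD w hw hw
  obtain ⟨t, ht, hS⟩ := exists_singleton_resolving hG hC ((isGate_gate hG hC).mem w)
  exact metricDim_add_two_le_of_pair hG hl hc hC hD hne ht fun S htS hm =>
    ⟨hS S htS (exists_gate_eq hG hm hC hD hne hw), fun v hvC hvD => absurd hvD (hCD v hvC)⟩

theorem metricDim_add_two_le_of_odd [Finite V] (hG : IsCactus G) (hl : ∀ v : V, ¬ IsLeaf G v)
    (hc : 2 ≤ numCycles G) {C : G.Subgraph} (hC : IsCycleOf C) (hodd : Odd C.edgeSet.ncard) :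
    metricDim G + 2 ≤ 2 * numCycles G := by
  obtain ⟨D, hD, hDC⟩ := exists_ne_of_two_le_numCycles hc (C := C)
  by_cases hCD : ∀ v ∈ C.verts, v ∉ D.verts
  · exact metricDim_add_two_le_of_disjoint hG hl hc hC hD hCD
  push Not at hCD
  obtain ⟨v, hvC, hvD⟩ := hCD
  obtain ⟨t, ht, hS⟩ := exists_singleton_of_odd hG hC hodd hvC
  refine metricDim_add_two_le_of_pair hG hl hc hC hD hDC.symm ht fun S htS hm => ?_
  obtain ⟨h1, h2⟩ := hS S htS (exists_gate_eq_of_mem hG hm hC hD hDC.symm hvC hvD)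
  refine ⟨h1, fun u huC huD => ?_⟩
  rwa [eq_of_mem_of_mem hG hC hD hDC.symm huC huD hvC hvD]

theorem metricDim_add_two_le_of_two_attachments [Finite V] (hG : IsCactus G)
    (hl : ∀ v : V, ¬ IsLeaf G v) (hc : 2 ≤ numCycles G) {C D E : G.Subgraph}
    (hC : IsCycleOf C) (hD : IsCycleOf D) (hE : IsCycleOf E) (hCD : C ≠ D) (hCE : C ≠ E)
    {u v : V} (hvC : v ∈ C.verts) (hvD : v ∈ D.verts) (huC : u ∈ C.verts) (huE : u ∈ E.verts)
    (huv : u ≠ v) : metricDim G + 2 ≤ 2 * numCycles G := by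
  obtain ⟨t, ht, hS⟩ := exists_singleton_of_two_gates hG hC hvC huC huv
  refine metricDim_add_two_le_of_pair hG hl hc hC hD hCD ht fun S htS hm => ?_
  obtain ⟨h1, h2⟩ := hS S htS (exists_gate_eq_of_mem hG hm hC hD hCD hvC hvD)
    (exists_gate_eq_of_mem hG hm hC hE hCE huC huE)
  refine ⟨h1, fun w hwC hwD => ?_⟩
  rwa [eq_of_mem_of_mem hG hC hD hCD hwC hwD hvC hvD]

end Upper

/-! ### Daisy graphs -/

section Daisy

variable {V : Type*} {G : SimpleGraph V}

/-- Two branches at a vertex outside all cycles would each contain a cycle through `v`; joining them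
at `v` produces a cycle through that vertex. -/
theorem exists_isCycleOf_of_common_vertex [Finite V] (hG : IsCactus G)
    (hl : ∀ v : V, ¬ IsLeaf G v) (hc : 2 ≤ numCycles G) {v : V}
    (hv : ∀ C : G.Subgraph, IsCycleOf C → v ∈ C.verts) (w : V) :
    ∃ C : G.Subgraph, IsCycleOf C ∧ w ∈ C.verts := by
  by_contra! hw
  have hwv : w ≠ v := by
    rintro rfl
    obtain ⟨C, hC, -⟩ := exists_ne_of_two_le_numCycles hc (C := ⊥)
    exact hw C hC (hv C hC)
  obtain ⟨q⟩ := hG.1.preconnected w v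
  cases q with
  | nil => exact hwv rfl
  | @cons _ z _ hz _ =>
    obtain ⟨z', hne, hz'⟩ := exists_adj_ne hl hz
    obtain ⟨C, hC, hCz⟩ := exists_cycle_in_branch hl hz hw
    obtain ⟨D, hD, hDz⟩ := exists_cycle_in_branch hl hz' hw
    obtain ⟨q, hq⟩ := hCz v (hv C hC)
    obtain ⟨q', hq'⟩ := hDz v (hv D hD)
    obtain ⟨B, hB, hwB⟩ := exists_isCycleOf_of_walk hz hz' hne.symm (q.reverse.append q') (by
      simp only [Walk.mem_support_append_iff, Walk.support_reverse, List.mem_reverse]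
      tauto)
    exact hw B hB hwB

theorem reachable_deleteEdges_of_mem {C : G.Subgraph} (hC : IsCycleOf C) {e : Sym2 V}
    (he : e ∉ C.edgeSet) {a b : V} (ha : a ∈ C.verts) (hb : b ∈ C.verts) :
    (G.deleteEdges {e}).Reachable a b := by
  classical
  obtain ⟨p, hp, rfl⟩ := hC.exists_walk ha
  rw [Walk.mem_verts_toSubgraph] at hb
  refine ⟨(p.takeUntil b hb).transfer _ fun f hf => ?_⟩
  have hf' := p.edges_takeUntil_subset_edges hb hf
  rw [edgeSet_deleteEdges]
  refine ⟨p.edges_subset_edgeSet hf', ?_⟩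
  rintro rfl
  exact he (by rwa [Walk.mem_edges_toSubgraph])

theorem isDaisy_of_meet [Finite V] (hG : IsCactus G) (hl : ∀ v : V, ¬ IsLeaf G v)
    (hc : 2 ≤ numCycles G)
    (hmeet : ∀ C D : G.Subgraph, IsCycleOf C → IsCycleOf D → ∃ v ∈ C.verts, v ∈ D.verts)
    (huniq : ∀ C D E : G.Subgraph, IsCycleOf C → IsCycleOf D → IsCycleOf E → C ≠ D → C ≠ E →
      ∀ v ∈ C.verts, v ∈ D.verts → ∀ u ∈ C.verts, u ∈ E.verts → u = v) : IsDaisy G := by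
  obtain ⟨C₀, hC₀, -⟩ := exists_ne_of_two_le_numCycles hc (C := ⊥)
  obtain ⟨C₁, hC₁, h10⟩ := exists_ne_of_two_le_numCycles hc (C := C₀)
  obtain ⟨v, hv0, hv1⟩ := hmeet C₀ C₁ hC₀ hC₁
  have hv : ∀ C : G.Subgraph, IsCycleOf C → v ∈ C.verts := by
    intro C hC
    by_cases h : C₀ = C
    · exact h ▸ hv0
    · obtain ⟨u, hu0, huC⟩ := hmeet C₀ C hC₀ hC
      rwa [← huniq C₀ C₁ C hC₀ hC₁ hC h10.symm h v hv0 hv1 u hu0 huC]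
  have hw := exists_isCycleOf_of_common_vertex hG hl hc hv
  refine ⟨hw, fun e he => ?_, v, hv, fun C D hC hD hCD => ?_⟩
  · by_contra! hcon
    induction e with
    | h a b =>
    -- An edge on no cycle is a bridge, yet its ends stay connected through `v` along cycles that
    -- avoid it.
    have hbr : G.IsBridge s(a, b) := by
      rw [isBridge_iff_forall_cycle_notMem he]
      intro u p hp hep
      exact hcon _ ⟨u, p, hp, rfl⟩ (by rwa [Walk.mem_edges_toSubgraph])
    rw [isBridge_iff] at hbr
    obtain ⟨A, hA, haA⟩ := hw a
    obtain ⟨B, hB, hbB⟩ := hw b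
    exact hbr ((reachable_deleteEdges_of_mem hA (hcon A hA) haA (hv A hA)).trans
      (reachable_deleteEdges_of_mem hB (hcon B hB) (hv B hB) hbB))
  · ext u
    simp only [Set.mem_inter_iff, Set.mem_singleton_iff]
    constructor
    · rintro ⟨h1, h2⟩
      exact eq_of_mem_of_mem hG hC hD hCD h1 h2 (hv C hC) (hv D hD)
    · rintro rfl
      exact ⟨hv C hC, hv D hD⟩

/-! ### Lower bound for daisy graphs with even petals -/

theorem exists_isMetricGenerator_card_eq [Finite V] (G : SimpleGraph V) (hG : G.Connected) :
    ∃ S : Finset V, IsMetricGenerator G S ∧ S.card = metricDim G := by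
  have := Fintype.ofFinite V
  refine Nat.sInf_mem (s := {n : ℕ | ∃ S : Finset V, IsMetricGenerator G S ∧ S.card = n})
    ⟨_, Finset.univ, fun x y hxy => ⟨x, Finset.mem_univ x, ?_⟩, rfl⟩
  rw [dist_self]
  exact fun h => hxy (hG.dist_eq_zero_iff.1 h.symm)

/-- An even cycle is bipartite, so stepping from `0` to a neighbour changes the distance to `k` by
exactly one. This fails for odd `L`. -/
theorem circDist_neighbor {L k : ℕ} (hL : 3 ≤ L) (heven : ¬ Odd L) (hk : k < L)
    (h : circDist L k 1 ≠ circDist L k (L - 1)) :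
    circDist L k 1 = circDist L k 0 + 1 ∨ circDist L k (L - 1) = circDist L k 0 + 1 := by
  rw [Nat.not_odd_iff_even] at heven
  obtain ⟨m, rfl⟩ := heven
  unfold circDist at *
  omega

theorem exists_adj_forall_dist_eq (hG : IsCactus G) {S : Finset V} (hS : IsMetricGenerator G S)
    {C : G.Subgraph} (hC : IsCycleOf C) (heven : ¬ Odd C.edgeSet.ncard) {v : V}
    (hv : v ∈ C.verts)
    (h : ∀ s ∈ S, ∀ s' ∈ S, gate C s ≠ v → gate C s' ≠ v → s = s') :
    ∃ x ∈ C.verts, G.Adj v x ∧ ∀ s ∈ S, G.dist s x = G.dist s v + 1 := by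
  obtain ⟨p, hp, rfl⟩ := hC.exists_walk hv
  have hL := hp.three_le_length
  have hr := isGate_gate hG hC
  rw [ncard_edgeSet_toSubgraph hp] at heven
  have h1 : G.Adj v (p.getVert 1) := by simpa using p.adj_getVert_succ (i := 0) (by omega)
  have h2 : G.Adj v (p.getVert (p.length - 1)) := by
    have := p.adj_getVert_succ (i := p.length - 1) (by omega)
    rw [Nat.sub_add_cancel (by omega), Walk.getVert_length] at this
    exact this.symm
  have hout : ∀ i, G.Adj v (p.getVert i) → ∀ s, gate p.toSubgraph s = v →
      G.dist s (p.getVert i) = G.dist s v + 1 := by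
    intro i hi s hs
    rw [hr.dist_eq_of_mem hG.1 s (getVert_mem_verts p i), hs, dist_eq_one_iff_adj.2 hi]
  obtain ⟨s, hs, hne⟩ := hS (p.getVert 1) (p.getVert (p.length - 1)) (fun he => by
    have := getVert_injective_of_lt hp (by omega) (by omega) he
    omega)
  have hsv : gate p.toSubgraph s ≠ v := fun hsv => hne (by rw [hout _ h1 s hsv, hout _ h2 s hsv])
  obtain ⟨k, hk, hks⟩ := exists_getVert_of_mem hp (hr.mem s)
  have e1 := hr.dist_eq_of_mem hG.1 s (getVert_mem_verts p 1)
  have e2 := hr.dist_eq_of_mem hG.1 s (getVert_mem_verts p (p.length - 1))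
  have e0 := hr.dist_eq_of_mem hG.1 s (getVert_mem_verts p 0)
  rw [← hks, dist_getVert_of_isCactus hG hp hk (by omega)] at e0 e1 e2
  rw [p.getVert_zero] at e0
  have hcase := circDist_neighbor hL heven hk (by omega)
  have hfin : ∀ i, G.Adj v (p.getVert i) → G.dist s (p.getVert i) = G.dist s v + 1 →
      ∀ s' ∈ S, G.dist s' (p.getVert i) = G.dist s' v + 1 := by
    intro i hi hi' s' hs'
    by_cases hg : gate p.toSubgraph s' = v
    · exact hout i hi s' hg
    · rwa [h s' hs' s hs hg hsv]
  rcases hcase with hcase | hcase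
  · exact ⟨_, getVert_mem_verts p _, h1, hfin _ h1 (by omega)⟩
  · exact ⟨_, getVert_mem_verts p _, h2, hfin _ h2 (by omega)⟩

theorem two_mul_numCycles_le_of_isDaisy [Finite V] (hG : IsCactus G)
    (hc : 2 ≤ numCycles G) (hd : IsDaisy G)
    (heven : ∀ C : G.Subgraph, IsCycleOf C → ¬ Odd C.edgeSet.ncard) :
    2 * numCycles G ≤ metricDim G + 1 := by
  classical
  obtain ⟨hcover, -, v, hv, hinter⟩ := hd
  obtain ⟨S, hS, hScard⟩ := exists_isMetricGenerator_card_eq G hG.1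
  have hfin : {C : G.Subgraph | IsCycleOf C}.Finite :=
    Set.finite_of_ncard_ne_zero (by unfold numCycles at hc; omega)
  set F := hfin.toFinset with hF
  have hmem : ∀ C, C ∈ F ↔ IsCycleOf C := fun C => by simp [hF]
  have hcard : numCycles G = F.card := Set.ncard_eq_toFinset_card _ hfin
  -- In a daisy these are the landmarks on the petal `C` other than the center.
  let A : G.Subgraph → Finset V := fun C => {s ∈ S | gate C s ≠ v}
  have hA : ∀ C : G.Subgraph, IsCycleOf C → ∀ s, gate C s ≠ v → s ∈ C.verts ∧ s ≠ v := by
    intro C hC s hs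
    have hr := isGate_gate hG hC
    refine ⟨by_contra fun hsC => hs ?_, ?_⟩
    · obtain ⟨D, hD, hsD⟩ := hcover s
      have hCD : C ≠ D := by
        rintro rfl
        exact hsC hsD
      rw [gate_eq_of_mem_of_ne hG hC hD hCD hsD (hv D hD), hr.self v (hv C hC)]
    · rintro rfl
      exact hs (hr.self _ (hv C hC))
  have hdisj : (F : Set G.Subgraph).PairwiseDisjoint A := by
    intro C hC D hD hCD
    rw [Finset.mem_coe, hmem] at hC hD
    rw [Function.onFun, Finset.disjoint_left]
    intro s hsC hsD
    have h1 := hA C hC s (Finset.mem_filter.1 hsC).2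
    have h2 := hA D hD s (Finset.mem_filter.1 hsD).2
    have h3 : s ∈ C.verts ∩ D.verts := ⟨h1.1, h2.1⟩
    rw [hinter C D hC hD hCD] at h3
    exact h1.2 h3
  have hsum : ∑ C ∈ F, (A C).card ≤ S.card := by
    rw [← Finset.card_biUnion hdisj]
    exact Finset.card_le_card (Finset.biUnion_subset.2 fun C _ => Finset.filter_subset _ _)
  have hone : ∀ C ∈ F, 1 ≤ (A C).card := by
    intro C hC
    rw [hmem] at hC
    have hres : ResolvesCycle S C := fun x _ y _ hxy => hS x y hxy
    obtain ⟨s, hs, hne⟩ := hres.exists_gate_ne hG hC (hv C hC)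
    exact Finset.card_pos.2 ⟨s, Finset.mem_filter.2 ⟨hs, hne⟩⟩
  have hadj : ∀ C : G.Subgraph, IsCycleOf C → (A C).card ≤ 1 →
      ∃ x ∈ C.verts, G.Adj v x ∧ ∀ s ∈ S, G.dist s x = G.dist s v + 1 := by
    intro C hC hcA
    refine exists_adj_forall_dist_eq hG hS hC (heven C hC) (hv C hC) fun s hs s' hs' h h' => ?_
    exact Finset.card_le_one.1 hcA s (Finset.mem_filter.2 ⟨hs, h⟩) s'
      (Finset.mem_filter.2 ⟨hs', h'⟩)
  have htwo : ∀ C ∈ F, ∀ D ∈ F, C ≠ D → (A C).card ≤ 1 → 2 ≤ (A D).card := by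
    intro C hC D hD hCD hcC
    rw [hmem] at hC hD
    by_contra hcD
    obtain ⟨x, hxC, hvx, hx⟩ := hadj C hC hcC
    obtain ⟨y, hyD, -, hy⟩ := hadj D hD (by omega)
    have hxy : x ≠ y := by
      rintro rfl
      have h3 : x ∈ C.verts ∩ D.verts := ⟨hxC, hyD⟩
      rw [hinter C D hC hD hCD] at h3
      exact hvx.ne' h3
    obtain ⟨s, hs, hne⟩ := hS x y hxy
    exact hne (by rw [hx s hs, hy s hs])
  rw [hcard, ← hScard]
  by_cases hex : ∃ C ∈ F, (A C).card ≤ 1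
  · obtain ⟨C, hC, hcC⟩ := hex
    have h1 := hone C hC
    have h2 := Finset.card_nsmul_le_sum (F.erase C) (fun D => (A D).card) 2 fun D hD =>
      htwo C hC D (Finset.mem_of_mem_erase hD) (Finset.ne_of_mem_erase hD).symm hcC
    have h3 := Finset.add_sum_erase F (fun D => (A D).card) hC
    rw [Finset.card_erase_of_mem hC, smul_eq_mul] at h2
    omega
  · push Not at hex
    have h2 := Finset.card_nsmul_le_sum F (fun D => (A D).card) 2 fun D hD => hex D hD
    rw [smul_eq_mul] at h2
    omega

end Daisy

end LeaflessCactus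

theorem mainTheorem1 {V : Type*} [Finite V] (G : SimpleGraph V)
    (hcactus : LeaflessCactus.IsCactus G)
    (hleafless : ∀ v : V, ¬ LeaflessCactus.IsLeaf G v)
    (hc : 2 ≤ LeaflessCactus.numCycles G) :
    LeaflessCactus.metricDim G ≤ 2 * LeaflessCactus.numCycles G - 1 ∧
    (LeaflessCactus.metricDim G = 2 * LeaflessCactus.numCycles G - 1 ↔
      LeaflessCactus.IsDaisy G ∧
        ∀ C : G.Subgraph, LeaflessCactus.IsCycleOf C → ¬ Odd C.edgeSet.ncard) := by
  have h1 := LeaflessCactus.metricDim_add_one_le hcactus hleafless hc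
  refine ⟨by omega, fun heq => ?_, fun ⟨hd, heven⟩ => ?_⟩
  · have hlt : ¬ LeaflessCactus.metricDim G + 2 ≤ 2 * LeaflessCactus.numCycles G := by omega
    refine ⟨LeaflessCactus.isDaisy_of_meet hcactus hleafless hc (fun C D hC hD => ?_)
      fun C D E hC hD hE hCD hCE v hvC hvD u huC huE => ?_, fun C hC hodd =>
        hlt (LeaflessCactus.metricDim_add_two_le_of_odd hcactus hleafless hc hC hodd)⟩
    · by_contra! hcon
      exact hlt (LeaflessCactus.metricDim_add_two_le_of_disjoint hcactus hleafless hc hC hD hcon)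
    · by_contra huv
      exact hlt (LeaflessCactus.metricDim_add_two_le_of_two_attachments hcactus hleafless hc
        hC hD hE hCD hCE hvC hvD huC huE huv)
  · have := LeaflessCactus.two_mul_numCycles_le_of_isDaisy hcactus hc hd heven
    omega
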